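/- Let $f,g\in\mathbb{R}[X,Y,Z]$ be symmetric homogeneous polynomials of degrees $d,e\ge 1$, and let $C=V(f)$ and $D=V(g)$ be the corresponding real symmetric curves in $\mathbb{P}^2_{\mathbb{C}}$. Assume that $C$ and $D$ are transverse, i.e. that at every point of $V(f,g)=C\cap D\subseteq\mathbb{P}^2_{\mathbb{C}}$ both curves are smooth and their tangent lines are distinct. Call a point of $\mathbb{P}^2_{\mathbb{C}}$ real if it has real homogeneous coordinates. (a) If $de\equiv 3$ or $5 \pmod 6$, then $V(f,g)$ has exactly $3+6k$ real points for some integer $0\le k<de/6$. (b) If $de\equiv 0$ or $2 \pmod 6$, then $V(f,g)$ has exactly $6k$ real points for some integer $0\le k\le de/6$. -/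

import Mathlib

open scoped LinearAlgebra.Projectivization

namespace PlaneCurve

/-- The complex projective plane. -/
abbrev P2 : Type := ℙ ℂ (Fin 3 → ℂ)

/-- The plane curve `V(f)`: the points of the projective plane at all of whose homogeneous
coordinate vectors `f` vanishes (for homogeneous `f`, one coordinate vector suffices, see
`mk_mem_zeroLocus_iff`). -/
def zeroLocus (f : MvPolynomial (Fin 3) ℂ) : Set P2 :=
  {P | ∀ (v : Fin 3 → ℂ) (hv : v ≠ 0), Projectivization.mk ℂ v hv = P → MvPolynomial.eval v f = 0}

theorem eval_smul_of_isHomogeneous {f : MvPolynomial (Fin 3) ℂ} {d : ℕ} (hf : f.IsHomogeneous d)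
    (a : ℂ) (v : Fin 3 → ℂ) :
    MvPolynomial.eval (a • v) f = a ^ d * MvPolynomial.eval v f := by
  rw [MvPolynomial.eval_eq', MvPolynomial.eval_eq', Finset.mul_sum]
  refine Finset.sum_congr rfl fun m hm => ?_
  have hdeg : ∑ i, m i = d := by
    rw [← hf (MvPolynomial.mem_support_iff.1 hm), Finsupp.weight_apply,
      Finsupp.sum_fintype _ _ (by simp)]
    simp
  simp only [Pi.smul_apply, smul_eq_mul, mul_pow, Finset.prod_mul_distrib,
    Finset.prod_pow_eq_pow_sum, hdeg]
  ring

theorem mk_mem_zeroLocus_iff {f : MvPolynomial (Fin 3) ℂ} {d : ℕ} (hf : f.IsHomogeneous d)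
    (v : Fin 3 → ℂ) (hv : v ≠ 0) :
    Projectivization.mk ℂ v hv ∈ zeroLocus f ↔ MvPolynomial.eval v f = 0 := by
  constructor
  · intro h
    exact h v hv rfl
  · intro h w hw hwv
    obtain ⟨a, rfl⟩ := (Projectivization.mk_eq_mk_iff' ℂ w v hw hv).1 hwv
    rw [eval_smul_of_isHomogeneous hf, h, mul_zero]

/-- The locus `V(f, g)`. -/
def interLocus (f g : MvPolynomial (Fin 3) ℂ) : Set P2 := zeroLocus f ∩ zeroLocus g

/-- The vector of partial derivatives of `f` at `v`. Where `f` is homogeneous and vanishes, `V(f)`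
is smooth at `[v]` iff this is nonzero, and then it is the coefficient vector of the tangent line
of `V(f)` at `[v]`. -/
noncomputable def gradAt (f : MvPolynomial (Fin 3) ℂ) (v : Fin 3 → ℂ) : Fin 3 → ℂ :=
  fun i => MvPolynomial.eval v (MvPolynomial.pderiv i f)

/-- `V(f)` and `V(g)` are transverse: at each point of their intersection both are smooth, and
their tangent lines are distinct. -/
def Transverse (f g : MvPolynomial (Fin 3) ℂ) : Prop :=
  ∀ (v : Fin 3 → ℂ) (hv : v ≠ 0), Projectivization.mk ℂ v hv ∈ interLocus f g →
    LinearIndependent ℂ ![gradAt f v, gradAt g v]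

/-- A point of the complex projective plane is real if it has real homogeneous coordinates. -/
def IsRealPoint (P : P2) : Prop :=
  ∃ (v : Fin 3 → ℂ) (hv : v ≠ 0), (∀ i, (v i).im = 0) ∧ Projectivization.mk ℂ v hv = P

/-- A real polynomial, viewed as a complex one. -/
noncomputable def complexify (f : MvPolynomial (Fin 3) ℝ) : MvPolynomial (Fin 3) ℂ :=
  MvPolynomial.map Complex.ofRealHom f

end PlaneCurve

/-! The symmetric group of degree 3 permutes the real points of `V(f, g)`. No intersection point has
two equal coordinates: there both gradients are fixed by a transposition and, by Euler's relation,
orthogonal to the point, hence proportional (`not_linearIndependent_gradAt_of_eq`). If a nontrivial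
permutation fixes a real point with distinct coordinates, it multiplies its coordinates by `-1`, and
the point is an `antiPoint` (`exists_swap_of_comp_eq_smul`). All other real points lie in free
orbits, of size 6. The three points `antiPoint k` all lie on both curves if `de` is odd. If `de` is
even, a curve of even degree through one of them would be singular there, so none is in `V(f, g)`.
The bounds on `k` come from Bézout's inequality; a common component is impossible, as both gradients
would be multiples of one vector along it. -/

namespace MvPolynomial

/-! ### Bézout's inequality by dimension counting. -/

theorem two_mul_finrank_homogeneousSubmodule_fin_three (K : Type*) [Field K] (n : ℕ) :
    2 * Module.finrank K (homogeneousSubmodule (Fin 3) K n) = (n + 1) * (n + 2) := by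
  have hset : {d : Fin 3 →₀ ℕ | d.degree = n} =
      ((Finset.univ : Finset (Fin 3)).finsuppAntidiag n : Set (Fin 3 →₀ ℕ)) := by
    ext d
    simp [Finset.mem_finsuppAntidiag, Finsupp.degree_eq_sum]
  rw [homogeneousSubmodule_eq_finsupp_supported, hset,
    (AddMonoidAlgebra.supportedEquivFinsupp _).finrank_eq]
  simp only [Module.finrank_finsupp_self, Finset.coe_sort_coe, Fintype.card_coe]
  rw [Finset.card_finsuppAntidiag_nat_eq_choose, Finset.card_univ, Fintype.card_fin,
    show 3 + n - 1 = n + 2 by omega, ← Nat.choose_symm (by omega), show n + 2 - n = 2 by omega,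
    Nat.choose_two_right, Nat.mul_div_cancel' (Nat.even_mul_pred_self _).two_dvd]
  simp [mul_comm]

theorem IsHomogeneous.of_mul_left {σ R : Type*} [CommRing R] [IsDomain R] {p q : MvPolynomial σ R}
    {m n : ℕ} (hp : p.IsHomogeneous m) (hp0 : p ≠ 0) (hpq : (p * q).IsHomogeneous (m + n)) :
    q.IsHomogeneous n := by
  classical
  let := gradedAlgebra (σ := σ) (R := R)
  have h := DirectSum.coe_decompose_mul_add_of_left_mem (homogeneousSubmodule σ R) (i := m) (j := n)
    (a := p) (b := q) hp
  rw [DirectSum.decompose_of_mem_same (homogeneousSubmodule σ R) hpq] at h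
  rw [mul_left_cancel₀ hp0 h]
  exact (DirectSum.decompose (homogeneousSubmodule σ R) q n).2

theorem exists_isHomogeneous_one_eval_ne_zero {σ K : Type*} [Field K] {v w : σ → K}
    (hw : w ≠ 0) (h : ∀ c : K, v ≠ c • w) :
    ∃ l : MvPolynomial σ K, l.IsHomogeneous 1 ∧ eval w l = 0 ∧ eval v l ≠ 0 := by
  obtain ⟨b, hb⟩ := Function.ne_iff.1 hw
  -- The form is a 2×2 minor of `v` and `w`; `a` is chosen so that it does not vanish at `v`.
  obtain ⟨a, ha⟩ := Function.ne_iff.1 (h (v b / w b))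
  refine ⟨C (w b) * X a - C (w a) * X b, (isHomogeneous_C_mul_X _ _).sub (isHomogeneous_C_mul_X _ _),
    by simp [mul_comm], ?_⟩
  simp only [Pi.smul_apply, smul_eq_mul, Pi.zero_apply, map_sub, map_mul, eval_C, eval_X] at *
  contrapose! ha
  field_simp
  linear_combination ha

/-- A product of linear forms, each vanishing at one of the other points but not at `v i`, padded to
degree `m` by a power of one nonzero at `v i`. -/
theorem exists_isHomogeneous_eval_eq_single {ι σ K : Type*} [Fintype ι] [DecidableEq ι] [Field K]
    {v : ι → σ → K} (hv : ∀ i, v i ≠ 0) (hind : ∀ i j, i ≠ j → ∀ c : K, v i ≠ c • v j)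
    {m : ℕ} (hm : Fintype.card ι ≤ m) (i : ι) :
    ∃ p : MvPolynomial σ K, p.IsHomogeneous m ∧ (fun j => eval (v j) p) = Pi.single i 1 := by
  have hl : ∀ j, ∃ l : MvPolynomial σ K, l.IsHomogeneous 1 ∧ (j ≠ i → eval (v j) l = 0) ∧
      eval (v i) l ≠ 0 := by
    intro j
    by_cases hj : j = i
    · obtain ⟨a, ha⟩ := Function.ne_iff.1 (hv i)
      exact ⟨X a, isHomogeneous_X _ _, fun h => absurd hj h, by simpa using ha⟩
    · obtain ⟨l, h1, h2, h3⟩ := exists_isHomogeneous_one_eval_ne_zero (hv j) (hind i j (Ne.symm hj))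
      exact ⟨l, h1, fun _ => h2, h3⟩
  choose l hl1 hl2 hl3 using hl
  let q := l i ^ (m - Fintype.card ι) * ∏ j, l j
  have hq : q.IsHomogeneous m := by
    have := ((hl1 i).pow (m - Fintype.card ι)).mul
      (IsHomogeneous.prod Finset.univ l (fun _ => 1) fun j _ => hl1 j)
    simpa [Nat.sub_add_cancel hm] using this
  have hqi : eval (v i) q ≠ 0 := by
    simp only [q, map_mul, map_pow, map_prod]
    exact mul_ne_zero (pow_ne_zero _ (hl3 i)) (Finset.prod_ne_zero_iff.2 fun j _ => hl3 j)
  refine ⟨C (eval (v i) q)⁻¹ * q, hq.C_mul _, ?_⟩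
  funext j
  by_cases hj : j = i
  · subst hj
    simp [hqi]
  · simp only [q, map_mul, map_pow, map_prod, eval_C, Pi.single_eq_of_ne hj]
    have h0 : ∏ k, eval (v j) (l k) = 0 := Finset.prod_eq_zero (Finset.mem_univ j) (hl2 j hj)
    simp [h0]

/-- Bézout's inequality for plane projective curves without common component. -/
theorem card_le_mul_of_isRelPrime {ι K : Type*} [Fintype ι] [Field K]
    {f g : MvPolynomial (Fin 3) K} {d e : ℕ} (hf : f.IsHomogeneous d) (hg : g.IsHomogeneous e)
    (hf0 : f ≠ 0) (hg0 : g ≠ 0) (hfg : IsRelPrime f g)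
    {v : ι → Fin 3 → K} (hv : ∀ i, v i ≠ 0) (hind : ∀ i j, i ≠ j → ∀ c : K, v i ≠ c • v j)
    (hvf : ∀ i, eval (v i) f = 0) (hvg : ∀ i, eval (v i) g = 0) :
    Fintype.card ι ≤ d * e := by
  classical
  set N := Fintype.card ι
  let S := homogeneousSubmodule (Fin 3) K
  have hfin : ∀ n, FiniteDimensional K (S n) := fun n =>
    Module.Finite.iff_fg.2 (homogeneousSubmodule_fg (Fin 3) K n)
  let ev : MvPolynomial (Fin 3) K →ₗ[K] (ι → K) := LinearMap.pi fun i => (aeval (v i)).toLinearMap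
  have hev : ∀ p, ev p = fun i => eval (v i) p := fun p => by
    funext i
    simp [ev]
  -- The summand `N` makes the degree large enough for evaluation at the `N` points to be onto.
  let φ := ev.domRestrict (S (d + e + N))
  have hsurj : Function.Surjective φ := by
    rw [← LinearMap.range_eq_top, eq_top_iff, ← (Pi.basisFun K ι).span_eq, Submodule.span_le]
    rintro _ ⟨i, rfl⟩
    obtain ⟨p, hp, hpi⟩ := exists_isHomogeneous_eval_eq_single hv hind
      (m := d + e + N) (Nat.le_add_left _ _) i
    exact ⟨⟨p, hp⟩, by simp [φ, hev, hpi]⟩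
  let A := (S (e + N)).map (LinearMap.mulLeft K f)
  let B := (S (d + N)).map (LinearMap.mulLeft K g)
  have hle : A ⊔ B ≤ (LinearMap.ker φ).map (S (d + e + N)).subtype := by
    rw [sup_le_iff]
    constructor
    · rintro _ ⟨p, hp, rfl⟩
      refine ⟨⟨f * p, ?_⟩, ?_, rfl⟩
      · have := hf.mul hp
        rwa [← add_assoc] at this
      · simp only [SetLike.mem_coe, LinearMap.mem_ker, φ, LinearMap.domRestrict_apply, hev]
        funext i
        simp [hvf]
    · rintro _ ⟨p, hp, rfl⟩
      refine ⟨⟨g * p, ?_⟩, ?_, rfl⟩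
      · have := hg.mul hp
        rwa [← add_assoc, add_comm e d] at this
      · simp only [SetLike.mem_coe, LinearMap.mem_ker, φ, LinearMap.domRestrict_apply, hev]
        funext i
        simp [hvg]
  have hinf : A ⊓ B ≤ (S N).map (LinearMap.mulLeft K (f * g)) := by
    rintro _ ⟨⟨a, ha, rfl⟩, ⟨b, hb, hab⟩⟩
    simp only [LinearMap.mulLeft_apply] at hab
    obtain ⟨c, rfl⟩ : g ∣ a := hfg.symm.dvd_of_dvd_mul_left ⟨b, hab.symm⟩
    exact ⟨c, hg.of_mul_left hg0 ha, by simp⟩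
  have hinj : ∀ {p : MvPolynomial (Fin 3) K}, p ≠ 0 → ∀ n,
      Module.finrank K ((S n).map (LinearMap.mulLeft K p)) = Module.finrank K (S n) := fun hp n =>
    ((S n).equivMapOfInjective (LinearMap.mulLeft K _) (mul_right_injective₀ hp)).finrank_eq.symm
  have h1 := Submodule.finrank_sup_add_finrank_inf_eq A B
  have h2 := Submodule.finrank_mono hle
  have h3 := Submodule.finrank_mono hinf
  have h4 := LinearMap.finrank_range_add_finrank_ker φ
  rw [LinearMap.range_eq_top.2 hsurj, finrank_top, Module.finrank_fintype_fun_eq_card] at h4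
  rw [Submodule.finrank_map_subtype_eq] at h2
  rw [hinj (mul_ne_zero hf0 hg0)] at h3
  rw [hinj hf0, hinj hg0] at h1
  have s1 := two_mul_finrank_homogeneousSubmodule_fin_three K (d + e + N)
  have s2 := two_mul_finrank_homogeneousSubmodule_fin_three K (e + N)
  have s3 := two_mul_finrank_homogeneousSubmodule_fin_three K (d + N)
  have s4 := two_mul_finrank_homogeneousSubmodule_fin_three K N
  have : 2 * N + (e + N + 1) * (e + N + 2) + (d + N + 1) * (d + N + 2) ≤
      (d + e + N + 1) * (d + e + N + 2) + (N + 1) * (N + 2) := by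
    rw [← s1, ← s2, ← s3, ← s4]
    change 2 * N + 2 * Module.finrank K (S _) + 2 * Module.finrank K (S _) ≤
      2 * Module.finrank K (S _) + 2 * Module.finrank K (S _)
    omega
  -- The mixed second difference of `(n + 1)(n + 2) / 2` with steps `d` and `e` is exactly `d * e`.
  nlinarith

/-- Otherwise, by the Nullstellensatz, `h` divides every variable, making `X 0` and `X 1`
associated. -/
theorem exists_ne_zero_eval_eq_zero_of_prime {h : MvPolynomial (Fin 3) ℂ} (hh : Prime h) :
    ∃ v : Fin 3 → ℂ, v ≠ 0 ∧ eval v h = 0 := by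
  by_contra! H
  have key : ∀ i : Fin 3, h ∣ X i := by
    intro i
    have hprime : (Ideal.span {h}).IsPrime := (Ideal.span_singleton_prime hh.ne_zero).2 hh
    rw [← Ideal.mem_span_singleton, ← IsPrime.vanishingIdeal_zeroLocus (K := ℂ) (Ideal.span {h}),
      mem_vanishingIdeal_iff]
    intro x hx
    have hx0 : eval x h = 0 := by
      have := hx h (Ideal.mem_span_singleton_self h)
      simpa [coe_aeval_eq_eval] using this
    have : x = 0 := by
      by_contra hne
      exact H x hne hx0
    simp [this]
  have hX : ∀ i : Fin 3, Associated h (X i) := fun i =>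
    hh.irreducible.associated_of_dvd (X_prime (i := i)).irreducible (key i)
  have h01 : (X 0 : MvPolynomial (Fin 3) ℂ) ∣ X 1 := ((hX 0).symm.trans (hX 1)).dvd
  simp [X_dvd_X] at h01

end MvPolynomial

/-! ### Transverse curves have no common component. -/

namespace PlaneCurve
open MvPolynomial

theorem mk_mem_interLocus_iff {f g : MvPolynomial (Fin 3) ℂ} {d e : ℕ} (hf : f.IsHomogeneous d)
    (hg : g.IsHomogeneous e) (v : Fin 3 → ℂ) (hv : v ≠ 0) :
    Projectivization.mk ℂ v hv ∈ interLocus f g ↔ eval v f = 0 ∧ eval v g = 0 :=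
  and_congr (mk_mem_zeroLocus_iff hf v hv) (mk_mem_zeroLocus_iff hg v hv)

theorem Transverse.isRelPrime {f g : MvPolynomial (Fin 3) ℂ} {d e : ℕ} (hf : f.IsHomogeneous d)
    (hg : g.IsHomogeneous e) (h : Transverse f g) (hfg : f ≠ 0 ∨ g ≠ 0) : IsRelPrime f g := by
  have hfg' : ¬ (f = 0 ∧ g = 0) := by tauto
  refine WfDvdMonoid.isRelPrime_of_no_irreducible_factors hfg' ?_
  rintro p hp ⟨a, rfl⟩ ⟨b, rfl⟩
  obtain ⟨v, hv, hpv⟩ := exists_ne_zero_eval_eq_zero_of_prime hp.prime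
  have hli := h v hv ((mk_mem_interLocus_iff hf hg v hv).2 (by simp [hpv]))
  have hgrad : ∀ q, gradAt (p * q) v = eval v q • gradAt p v := by
    intro q
    funext i
    simp [gradAt, Derivation.leibniz, hpv]
  rw [hgrad, hgrad, LinearIndependent.pair_iff] at hli
  have hb : eval v b = 0 := by
    have := hli (eval v b) (-eval v a) (by rw [smul_smul, smul_smul, ← add_smul]; simp [mul_comm])
    exact this.1
  have := hli 0 1 (by simp [hb])
  simp at this

theorem Transverse.symm {f g : MvPolynomial (Fin 3) ℂ} (h : Transverse f g) : Transverse g f :=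
  fun v hv hm => (LinearIndependent.pair_symm_iff).1 (h v hv hm.symm)

theorem Transverse.ne_zero_left {f g : MvPolynomial (Fin 3) ℂ} {e : ℕ} (he : 1 ≤ e)
    (hg : g.IsHomogeneous e) (h : Transverse f g) : f ≠ 0 := by
  rintro rfl
  obtain ⟨v, hv, hgv⟩ : ∃ v : Fin 3 → ℂ, v ≠ 0 ∧ eval v g = 0 := by
    by_cases hg0 : g = 0
    · exact ⟨1, one_ne_zero, by simp [hg0]⟩
    have hu : ¬ IsUnit g := by
      intro hu
      obtain ⟨c, hc, rfl⟩ := isUnit_iff_eq_C_of_isReduced.1 hu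
      exact absurd (hg.inj_right (isHomogeneous_C _ _) hg0) (by omega)
    obtain ⟨p, hp, a, rfl⟩ := WfDvdMonoid.exists_irreducible_factor hu hg0
    obtain ⟨v, hv, hpv⟩ := exists_ne_zero_eval_eq_zero_of_prime hp.prime
    exact ⟨v, hv, by simp [hpv]⟩
  have hli := h v hv ((mk_mem_interLocus_iff (isHomogeneous_zero _ _ 0) hg v hv).2 (by simp [hgv]))
  exact hli.ne_zero 0 (by funext i; simp [gradAt])

end PlaneCurve

/-! ### Gradients of symmetric forms. -/

namespace MvPolynomial

theorem IsSymmetric.eval_comp_perm {σ R : Type*} [CommSemiring R] {f : MvPolynomial σ R}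
    (hf : f.IsSymmetric) (s : Equiv.Perm σ) (v : σ → R) : eval (v ∘ s) f = eval v f := by
  conv_rhs => rw [← hf s]
  rw [eval_rename]

end MvPolynomial

namespace PlaneCurve
open MvPolynomial

theorem exists_third {i j : Fin 3} (hij : i ≠ j) :
    ∃ k, k ≠ i ∧ k ≠ j ∧ (Finset.univ : Finset (Fin 3)) = {i, j, k} := by
  revert i j; decide

section Gradient

variable {f g : MvPolynomial (Fin 3) ℂ} {d e : ℕ}

theorem gradAt_comp_perm (hf : f.IsSymmetric) (s : Equiv.Perm (Fin 3)) (v : Fin 3 → ℂ) :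
    gradAt f (v ∘ s) = gradAt f v ∘ s := by
  funext i
  simp only [gradAt, Function.comp_apply]
  conv_rhs => rw [← hf s]
  rw [pderiv_rename s.injective, eval_rename]

theorem sum_mul_gradAt (hf : f.IsHomogeneous d) (v : Fin 3 → ℂ) :
    ∑ i, v i * gradAt f v i = d * eval v f := by
  simpa [gradAt] using congrArg (eval v) hf.sum_X_mul_pderiv

theorem gradAt_neg (hf : f.IsHomogeneous d) (v : Fin 3 → ℂ) :
    gradAt f (-v) = (-1) ^ (d - 1) • gradAt f v := by
  funext i
  have := eval_smul_of_isHomogeneous (hf.pderiv (i := i)) (-1) v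
  simpa [gradAt] using this

/-- A symmetric curve has at most one possible tangent line at a point on a reflection line. -/
theorem not_linearIndependent_gradAt_of_eq (hf : f.IsHomogeneous d) (hg : g.IsHomogeneous e)
    (hfs : f.IsSymmetric) (hgs : g.IsSymmetric) {v : Fin 3 → ℂ} (hv : v ≠ 0)
    (hvf : eval v f = 0) (hvg : eval v g = 0) {i j : Fin 3} (hij : i ≠ j) (hvij : v i = v j) :
    ¬ LinearIndependent ℂ ![gradAt f v, gradAt g v] := by
  obtain ⟨k, hki, hkj, hk⟩ : ∃ k, k ≠ i ∧ k ≠ j ∧ (Finset.univ : Finset (Fin 3)) = {i, j, k} :=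
    exists_third hij
  have hall : ∀ l, l = i ∨ l = j ∨ l = k := fun l => by
    simpa [hk] using Finset.mem_univ l
  have hsum : ∀ a : Fin 3 → ℂ, ∑ l, a l = a i + a j + a k := fun a => by
    rw [hk, Finset.sum_insert (by simp [hij, hki.symm]), Finset.sum_pair hkj.symm, add_assoc]
  have hswap : v ∘ Equiv.swap i j = v := by
    funext l
    rcases hall l with rfl | rfl | rfl <;>
      simp [hvij, Equiv.swap_apply_of_ne_of_ne hki hkj]
  have hsym : ∀ {p : MvPolynomial (Fin 3) ℂ}, p.IsSymmetric → gradAt p v i = gradAt p v j := by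
    intro p hp
    have := congrFun (gradAt_comp_perm hp (Equiv.swap i j) v) i
    simpa [hswap] using this
  have hf' := sum_mul_gradAt hf v
  have hg' := sum_mul_gradAt hg v
  rw [hsum, hvf, mul_zero, ← hvij, ← hsym hfs] at hf'
  rw [hsum, hvg, mul_zero, ← hvij, ← hsym hgs] at hg'
  -- Euler's relation makes both pairs (`i`-entry, `k`-entry) orthogonal to the nonzero vector `(2 *
  -- v i, v k)`.
  have hdet : gradAt g v k * gradAt f v i = gradAt f v k * gradAt g v i := by
    by_cases hvi : v i = 0
    · have hvk : v k ≠ 0 := fun hvk => hv <| by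
        funext l
        rcases hall l with rfl | rfl | rfl <;> simp [hvi, hvk, ← hvij]
      have h1 : gradAt f v k = 0 := by simpa [hvi, hvk] using hf'
      have h2 : gradAt g v k = 0 := by simpa [hvi, hvk] using hg'
      rw [h1, h2]
      ring
    · refine mul_left_cancel₀ (mul_ne_zero two_ne_zero hvi) ?_
      linear_combination gradAt g v k * hf' - gradAt f v k * hg'
  intro hli
  rw [LinearIndependent.pair_iff] at hli
  have h1 := hli (gradAt g v k) (-gradAt f v k) <| by
    funext l
    rcases hall l with rfl | rfl | rfl <;>
      simp only [Pi.add_apply, Pi.smul_apply, smul_eq_mul, Pi.zero_apply, ← hsym hfs, ← hsym hgs]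
    · linear_combination hdet
    · linear_combination hdet
    · ring
  have h2 := hli (gradAt g v i) (-gradAt f v i) <| by
    funext l
    rcases hall l with rfl | rfl | rfl <;>
      simp only [Pi.add_apply, Pi.smul_apply, smul_eq_mul, Pi.zero_apply, ← hsym hfs, ← hsym hgs]
    · ring
    · ring
    · linear_combination -hdet
  have h3 := hli 1 0 <| by
    funext l
    rcases hall l with rfl | rfl | rfl <;>
      simp [← hsym hfs, neg_eq_zero.1 h1.2, neg_eq_zero.1 h2.2]
  exact one_ne_zero h3.1

theorem eval_eq_zero_of_comp_eq_neg (hf : f.IsHomogeneous d) (hfs : f.IsSymmetric) (hd : Odd d)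
    {v : Fin 3 → ℂ} {s : Equiv.Perm (Fin 3)} (hs : v ∘ s = -v) : eval v f = 0 := by
  have h := hfs.eval_comp_perm s v
  have h' := eval_smul_of_isHomogeneous hf (-1) v
  rw [hs] at h
  rw [neg_one_smul, h, hd.neg_one_pow] at h'
  linear_combination h' / 2

/-- A symmetric form of even degree is singular at each zero which a transposition maps to its
negative. -/
theorem gradAt_eq_zero_of_comp_swap_eq_neg (hf : f.IsHomogeneous d) (hfs : f.IsSymmetric)
    (hd1 : 1 ≤ d) (hd : Even d) {v : Fin 3 → ℂ} (hv : v ≠ 0) (hvf : eval v f = 0)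
    {i j : Fin 3} (hij : i ≠ j) (hs : v ∘ Equiv.swap i j = -v) : gradAt f v = 0 := by
  obtain ⟨k, hki, hkj, hk⟩ : ∃ k, k ≠ i ∧ k ≠ j ∧ (Finset.univ : Finset (Fin 3)) = {i, j, k} :=
    exists_third hij
  have hall : ∀ l, l = i ∨ l = j ∨ l = k := fun l => by
    simpa [hk] using Finset.mem_univ l
  -- The partial derivatives have odd degree `d - 1`. So `v` and the gradient are both multiples of
  -- `e_i - e_j`, yet orthogonal by Euler's relation.
  have hgrad : gradAt f v ∘ Equiv.swap i j = - gradAt f v := by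
    rw [← gradAt_comp_perm hfs, hs, gradAt_neg hf,
      (Nat.Even.sub_odd hd1 hd odd_one).neg_one_pow, neg_one_smul]
  have hneg : ∀ {w : Fin 3 → ℂ}, w ∘ Equiv.swap i j = -w → w j = -w i ∧ w k = 0 := by
    intro w hw
    have h1 := congrFun hw i
    have h2 := congrFun hw k
    simp only [Function.comp_apply, Equiv.swap_apply_left, Pi.neg_apply,
      Equiv.swap_apply_of_ne_of_ne hki hkj] at h1 h2
    exact ⟨h1, by linear_combination h2 / 2⟩
  obtain ⟨hvj, hvk⟩ := hneg hs
  obtain ⟨haj, hak⟩ := hneg hgrad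
  have hvi : v i ≠ 0 := fun hvi => hv <| by
    funext l
    rcases hall l with rfl | rfl | rfl <;> simp [hvi, hvk, hvj]
  have hsum := sum_mul_gradAt hf v
  rw [hk, Finset.sum_insert (by simp [hij, hki.symm]), Finset.sum_pair hkj.symm, hvf, hvj, haj,
    hak] at hsum
  have hai : gradAt f v i = 0 := by
    refine mul_left_cancel₀ (mul_ne_zero two_ne_zero hvi) ?_
    linear_combination hsum
  funext l
  rcases hall l with rfl | rfl | rfl <;> simp [hai, haj, hak]

end Gradient

/-! ### The three exceptional points. -/

section Antisymmetric

/-- The vector with coordinates `0`, `1`, `-1` at `k`, `k + 1`, `k + 2`. -/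
def antiVec (k : Fin 3) : Fin 3 → ℂ := Pi.single (k + 1) 1 - Pi.single (k + 2) 1

theorem antiVec_apply_self (k : Fin 3) : antiVec k k = 0 := by
  fin_cases k <;> simp [antiVec]

theorem antiVec_apply_add_one (k : Fin 3) : antiVec k (k + 1) = 1 := by
  fin_cases k <;> simp [antiVec]

theorem antiVec_apply_add_two (k : Fin 3) : antiVec k (k + 2) = -1 := by
  fin_cases k <;> simp [antiVec]

theorem antiVec_ne_zero (k : Fin 3) : antiVec k ≠ 0 := fun h => by
  simpa [antiVec_apply_add_one] using congrFun h (k + 1)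

theorem eq_or_eq_add_one_or_eq_add_two (k l : Fin 3) : l = k ∨ l = k + 1 ∨ l = k + 2 := by
  revert k l; decide

theorem ne_add_one_and_ne_add_two (k : Fin 3) : k ≠ k + 1 ∧ k ≠ k + 2 ∧ k + 1 ≠ k + 2 := by
  revert k; decide

theorem eq_of_antiVec_apply_eq_zero {k l : Fin 3} (h : antiVec k l = 0) : l = k := by
  rcases eq_or_eq_add_one_or_eq_add_two k l with rfl | rfl | rfl
  · rfl
  · simp [antiVec_apply_add_one] at h
  · simp [antiVec_apply_add_two] at h

/-- The points `[0 : 1 : -1]`, `[-1 : 0 : 1]` and `[1 : -1 : 0]`. -/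
noncomputable def antiPoint (k : Fin 3) : P2 := Projectivization.mk ℂ (antiVec k) (antiVec_ne_zero k)

theorem antiPoint_injective : Function.Injective antiPoint := by
  intro k l h
  obtain ⟨a, ha⟩ := (Projectivization.mk_eq_mk_iff' ℂ _ _ _ _).1 h
  have hz : a • antiVec l l = antiVec k l := congrFun ha l
  rw [antiVec_apply_self, smul_zero] at hz
  exact (eq_of_antiVec_apply_eq_zero hz.symm).symm

theorem isRealPoint_antiPoint (k : Fin 3) : IsRealPoint (antiPoint k) := by
  refine ⟨antiVec k, antiVec_ne_zero k, fun i => ?_, rfl⟩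
  rcases eq_or_eq_add_one_or_eq_add_two k i with rfl | rfl | rfl <;>
    simp [antiVec_apply_self, antiVec_apply_add_one, antiVec_apply_add_two]

theorem antiVec_comp_swap (k : Fin 3) : antiVec k ∘ Equiv.swap (k + 1) (k + 2) = -antiVec k := by
  funext l
  rcases eq_or_eq_add_one_or_eq_add_two k l with rfl | rfl | rfl
  · rw [Function.comp_apply, Equiv.swap_apply_of_ne_of_ne (ne_add_one_and_ne_add_two l).1
      (ne_add_one_and_ne_add_two l).2.1, Pi.neg_apply, antiVec_apply_self, neg_zero]
  · simp [antiVec_apply_add_one, antiVec_apply_add_two]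
  · simp [antiVec_apply_add_one, antiVec_apply_add_two]

theorem mk_mem_range_antiPoint {v : Fin 3 → ℂ} (hv : v ≠ 0) {i j : Fin 3} (hij : i ≠ j)
    (hs : v ∘ Equiv.swap i j = -v) : Projectivization.mk ℂ v hv ∈ Set.range antiPoint := by
  obtain ⟨k, hk⟩ : ∃ k : Fin 3, Equiv.swap i j = Equiv.swap (k + 1) (k + 2) := by
    clear hs
    revert i j; decide
  rw [hk] at hs
  refine ⟨k, ?_⟩
  have h1 : v (k + 2) = -v (k + 1) := by simpa using congrFun hs (k + 1)
  have h0 : v k = 0 := by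
    have := congrFun hs k
    rw [Function.comp_apply, Equiv.swap_apply_of_ne_of_ne (ne_add_one_and_ne_add_two k).1
      (ne_add_one_and_ne_add_two k).2.1, Pi.neg_apply] at this
    linear_combination this / 2
  refine ((Projectivization.mk_eq_mk_iff' ℂ _ _ _ _).2 ⟨v (k + 1), ?_⟩).symm
  funext l
  rcases eq_or_eq_add_one_or_eq_add_two k l with rfl | rfl | rfl <;>
    simp [antiVec_apply_self, antiVec_apply_add_one, antiVec_apply_add_two, h0, h1]

/-- A nontrivial permutation which fixes a real point with pairwise distinct coordinates negates
its coordinates, and then some transposition does so too. -/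
theorem exists_swap_of_comp_eq_smul {v : Fin 3 → ℂ} (hreal : ∀ i, (v i).im = 0)
    (hinj : Function.Injective v) {s : Equiv.Perm (Fin 3)} (hs1 : s ≠ 1) {c : ℂ}
    (hs : v ∘ s = c • v) : ∃ i j, i ≠ j ∧ v ∘ Equiv.swap i j = -v := by
  obtain ⟨w, rfl⟩ : ∃ w : Fin 3 → ℝ, v = fun i => (w i : ℂ) :=
    ⟨fun i => (v i).re, funext fun i => Complex.ext rfl (hreal i)⟩
  -- The sum of squares is permutation-invariant and, for real coordinates, nonzero, which forces `c
  -- ^ 2 = 1`.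
  have hne : ∑ i, w i ^ 2 ≠ 0 := by
    intro h
    rw [Finset.sum_eq_zero_iff_of_nonneg fun i _ => sq_nonneg _] at h
    have h0 : w 0 = 0 := by simpa using h 0 (Finset.mem_univ _)
    have h1 : w 1 = 0 := by simpa using h 1 (Finset.mem_univ _)
    exact absurd (hinj (show (w 0 : ℂ) = w 1 by rw [h0, h1])) (by decide)
  have hsum : c ^ 2 * ∑ i, (w i : ℂ) ^ 2 = ∑ i, (w i : ℂ) ^ 2 := by
    rw [Finset.mul_sum, ← Equiv.sum_comp s (fun i => (w i : ℂ) ^ 2)]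
    refine Finset.sum_congr rfl fun i _ => ?_
    have := congrFun hs i
    simp only [Function.comp_apply, Pi.smul_apply, smul_eq_mul] at this
    rw [this, mul_pow]
  have hc : c ^ 2 = 1 := mul_right_cancel₀ (by exact_mod_cast hne) (hsum.trans (one_mul _).symm)
  rcases (sq_eq_sq_iff_eq_or_eq_neg.1 (hc.trans (one_pow 2).symm)) with rfl | rfl
  · refine absurd (Equiv.ext fun i => hinj ?_) hs1
    simpa using congrFun hs i
  · rw [neg_one_smul] at hs
    have hss : s * s = 1 := Equiv.ext fun i => hinj <| by
      have h1 := congrFun hs i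
      have h2 := congrFun hs (s i)
      simp only [Function.comp_apply, Pi.neg_apply, Equiv.Perm.mul_apply, Equiv.Perm.one_apply]
        at *
      rw [h2, h1, neg_neg]
    obtain ⟨i, j, hij, rfl⟩ : ∃ i j, i ≠ j ∧ s = Equiv.swap i j := by
      clear hs
      revert s; decide
    exact ⟨i, j, hij, hs⟩

end Antisymmetric

/-! ### Counting real points by orbits. -/

section Counting

variable {f g : MvPolynomial (Fin 3) ℂ} {d e : ℕ}

/-- Bézout's inequality for transverse curves. -/
theorem Transverse.encard_interLocus_le (hd : 1 ≤ d) (he : 1 ≤ e) (hf : f.IsHomogeneous d)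
    (hg : g.IsHomogeneous e) (h : Transverse f g) : (interLocus f g).encard ≤ (d * e : ℕ) := by
  have hf0 := h.ne_zero_left he hg
  have hg0 := h.symm.ne_zero_left hd hf
  by_contra! hlt
  -- A subset of `d * e + 1` points suffices, so finiteness of the locus need not be known
  -- beforehand.
  obtain ⟨t, ht, hcard⟩ := Set.exists_subset_encard_eq (Order.add_one_le_of_lt hlt)
  have hfin : t.Finite := Set.finite_of_encard_eq_coe (k := d * e + 1) (by simpa using hcard)
  have := hfin.fintype
  have hmem : ∀ P : t, eval P.1.rep f = 0 ∧ eval P.1.rep g = 0 := fun P => by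
    rw [← mk_mem_interLocus_iff hf hg _ P.1.rep_nonzero, Projectivization.mk_rep]
    exact ht P.2
  have hle := card_le_mul_of_isRelPrime hf hg hf0 hg0 (h.isRelPrime hf hg (Or.inl hf0))
    (v := fun P : t => P.1.rep) (fun P => P.1.rep_nonzero) (fun P Q hPQ c hc => hPQ <| by
      refine Subtype.ext ?_
      rw [← P.1.mk_rep, ← Q.1.mk_rep, Projectivization.mk_eq_mk_iff']
      exact ⟨c, hc.symm⟩) (fun P => (hmem P).1) (fun P => (hmem P).2)
  rw [Set.encard_eq_coe_toFinset_card, Set.toFinset_card] at hcard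
  norm_cast at hcard
  omega

theorem mk_smul_mk (s : Equiv.Perm (Fin 3)) (v : Fin 3 → ℂ) (hv : v ≠ 0) :
    ∃ hv' : v ∘ s ≠ 0, DomMulAct.mk s • Projectivization.mk ℂ v hv =
      Projectivization.mk ℂ (v ∘ s) hv' :=
  ⟨_, Projectivization.smul_mk (DomMulAct.mk s) hv⟩

theorem smul_mem_interLocus (hf : f.IsHomogeneous d) (hg : g.IsHomogeneous e)
    (hfs : f.IsSymmetric) (hgs : g.IsSymmetric) (s : (Equiv.Perm (Fin 3))ᵈᵐᵃ) {P : P2}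
    (hP : P ∈ interLocus f g) : s • P ∈ interLocus f g := by
  induction P using Projectivization.ind with | _ v hv
  obtain ⟨s, rfl⟩ := DomMulAct.mk.surjective s
  obtain ⟨hv', h⟩ := mk_smul_mk s v hv
  rw [h, mk_mem_interLocus_iff hf hg, hfs.eval_comp_perm, hgs.eval_comp_perm]
  exact (mk_mem_interLocus_iff hf hg v hv).1 hP

theorem IsRealPoint.smul (s : (Equiv.Perm (Fin 3))ᵈᵐᵃ) {P : P2} (hP : IsRealPoint P) :
    IsRealPoint (s • P) := by
  obtain ⟨v, hv, hreal, rfl⟩ := hP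
  obtain ⟨s, rfl⟩ := DomMulAct.mk.surjective s
  obtain ⟨hv', h⟩ := mk_smul_mk s v hv
  exact ⟨v ∘ s, hv', fun i => hreal _, h.symm⟩

theorem smul_mem_range_antiPoint (s : (Equiv.Perm (Fin 3))ᵈᵐᵃ) {P : P2}
    (hP : P ∈ Set.range antiPoint) : s • P ∈ Set.range antiPoint := by
  obtain ⟨k, rfl⟩ := hP
  obtain ⟨s, rfl⟩ := DomMulAct.mk.surjective s
  obtain ⟨hv', h⟩ := mk_smul_mk s _ (antiVec_ne_zero k)
  rw [antiPoint, h]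
  refine mk_mem_range_antiPoint hv' (i := s⁻¹ (k + 1)) (j := s⁻¹ (k + 2))
    (s⁻¹.injective.ne (ne_add_one_and_ne_add_two k).2.2) ?_
  rw [Equiv.swap_apply_apply]
  funext l
  simpa using congrFun (antiVec_comp_swap k) (s l)

/-- The real points of `V(f, g)` off the three points `antiPoint k` fall into free orbits of the
symmetric group. -/
theorem exists_encard_diff_range_antiPoint_eq (hd : 1 ≤ d) (he : 1 ≤ e)
    (hf : f.IsHomogeneous d) (hg : g.IsHomogeneous e) (hfs : f.IsSymmetric) (hgs : g.IsSymmetric)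
    (h : Transverse f g) :
    ∃ k : ℕ, ({P ∈ interLocus f g | IsRealPoint P} \ Set.range antiPoint).encard =
      ((6 * k : ℕ) : ℕ∞) := by
  let R : SubMulAction (Equiv.Perm (Fin 3))ᵈᵐᵃ P2 :=
    { carrier := {P ∈ interLocus f g | IsRealPoint P} \ Set.range antiPoint
      smul_mem' := fun s P hP => ⟨⟨smul_mem_interLocus hf hg hfs hgs s hP.1.1, hP.1.2.smul s⟩,
        fun hs => hP.2 (by simpa using smul_mem_range_antiPoint s⁻¹ hs)⟩ }
  have hfree : ∀ P : R, MulAction.stabilizer (Equiv.Perm (Fin 3))ᵈᵐᵃ P = ⊥ := by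
    rintro ⟨P, ⟨hP, v, hv, hreal, rfl⟩, hanti⟩
    rw [eq_bot_iff]
    intro s hs
    obtain ⟨s, rfl⟩ := DomMulAct.mk.surjective s
    have hs' := congrArg Subtype.val (MulAction.mem_stabilizer_iff.1 hs)
    obtain ⟨hv', hmk⟩ := mk_smul_mk s v hv
    rw [SubMulAction.val_smul, hmk] at hs'
    obtain ⟨c, hc⟩ := (Projectivization.mk_eq_mk_iff' ℂ _ _ _ _).1 hs'
    have hev := (mk_mem_interLocus_iff hf hg v hv).1 hP
    have hinj : Function.Injective v := fun i j hij => by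
      by_contra hne
      exact not_linearIndependent_gradAt_of_eq hf hg hfs hgs hv hev.1 hev.2 hne hij (h v hv hP)
    by_contra hs1
    obtain ⟨i, j, hij, hswap⟩ := exists_swap_of_comp_eq_smul hreal hinj (s := s)
      (by rintro rfl; exact hs1 (one_mem _)) hc.symm
    exact hanti (mk_mem_range_antiPoint hv hij hswap)
  have hfin : ({P ∈ interLocus f g | IsRealPoint P} \ Set.range antiPoint).Finite :=
    (Set.finite_of_encard_le_coe (h.encard_interLocus_le hd he hf hg)).subset
      fun P hP => hP.1.1
  -- `k` is the number of orbits.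
  refine ⟨Nat.card (Quotient (MulAction.orbitRel (Equiv.Perm (Fin 3))ᵈᵐᵃ R)), ?_⟩
  rw [← hfin.cast_ncard_eq, ← Nat.card_coe_set_eq]
  have hcard := Nat.card_congr (MulAction.selfEquivOrbitsQuotientProd hfree)
  rw [Nat.card_prod, ← Nat.card_congr (DomMulAct.mk (M := Equiv.Perm (Fin 3))), Nat.card_perm,
    Nat.card_fin, mul_comm] at hcard
  exact congrArg _ hcard

theorem antiPoint_mem_interLocus (hf : f.IsHomogeneous d) (hg : g.IsHomogeneous e)
    (hfs : f.IsSymmetric) (hgs : g.IsSymmetric) (hde : Odd (d * e)) (k : Fin 3) :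
    antiPoint k ∈ interLocus f g :=
  (mk_mem_interLocus_iff hf hg _ _).2
    ⟨eval_eq_zero_of_comp_eq_neg hf hfs (Nat.odd_mul.1 hde).1 (antiVec_comp_swap k),
      eval_eq_zero_of_comp_eq_neg hg hgs (Nat.odd_mul.1 hde).2 (antiVec_comp_swap k)⟩

theorem antiPoint_notMem_interLocus (hd : 1 ≤ d) (he : 1 ≤ e) (hf : f.IsHomogeneous d)
    (hg : g.IsHomogeneous e) (hfs : f.IsSymmetric) (hgs : g.IsSymmetric) (h : Transverse f g)
    (hde : Even (d * e)) (k : Fin 3) : antiPoint k ∉ interLocus f g := by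
  intro hk
  have hli := h _ _ hk
  have hev := (mk_mem_interLocus_iff hf hg _ _).1 hk
  have hne := (ne_add_one_and_ne_add_two k).2.2
  rcases Nat.even_mul.1 hde with hd' | he'
  · exact hli.ne_zero 0 (gradAt_eq_zero_of_comp_swap_eq_neg hf hfs hd hd' (antiVec_ne_zero k) hev.1
      hne (antiVec_comp_swap k))
  · exact hli.ne_zero 1 (gradAt_eq_zero_of_comp_swap_eq_neg hg hgs he he' (antiVec_ne_zero k) hev.2
      hne (antiVec_comp_swap k))

theorem encard_realPoints_le (hd : 1 ≤ d) (he : 1 ≤ e) (hf : f.IsHomogeneous d)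
    (hg : g.IsHomogeneous e) (h : Transverse f g) :
    {P ∈ interLocus f g | IsRealPoint P}.encard ≤ (d * e : ℕ) :=
  (Set.encard_le_encard fun _ hP => hP.1).trans (h.encard_interLocus_le hd he hf hg)

theorem exists_encard_realPoints_of_odd (hd : 1 ≤ d) (he : 1 ≤ e) (hf : f.IsHomogeneous d)
    (hg : g.IsHomogeneous e) (hfs : f.IsSymmetric) (hgs : g.IsSymmetric) (h : Transverse f g)
    (hde : Odd (d * e)) :
    ∃ k : ℕ, {P ∈ interLocus f g | IsRealPoint P}.encard = ((3 + 6 * k : ℕ) : ℕ∞) := by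
  obtain ⟨k, hk⟩ := exists_encard_diff_range_antiPoint_eq hd he hf hg hfs hgs h
  refine ⟨k, ?_⟩
  have hsub : Set.range antiPoint ⊆ {P ∈ interLocus f g | IsRealPoint P} := by
    rintro _ ⟨k, rfl⟩
    exact ⟨antiPoint_mem_interLocus hf hg hfs hgs hde k, isRealPoint_antiPoint k⟩
  have hthree : (Set.range antiPoint).encard = 3 := by
    rw [← Set.image_univ, antiPoint_injective.encard_image]
    simp
  rw [← Set.encard_sdiff_add_encard_of_subset hsub, hk, hthree, add_comm]
  norm_cast

theorem exists_encard_realPoints_of_even (hd : 1 ≤ d) (he : 1 ≤ e) (hf : f.IsHomogeneous d)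
    (hg : g.IsHomogeneous e) (hfs : f.IsSymmetric) (hgs : g.IsSymmetric) (h : Transverse f g)
    (hde : Even (d * e)) :
    ∃ k : ℕ, {P ∈ interLocus f g | IsRealPoint P}.encard = ((6 * k : ℕ) : ℕ∞) := by
  obtain ⟨k, hk⟩ := exists_encard_diff_range_antiPoint_eq hd he hf hg hfs hgs h
  refine ⟨k, ?_⟩
  rwa [sdiff_eq_left.2] at hk
  rw [Set.disjoint_right]
  rintro _ ⟨k, rfl⟩ hP
  exact antiPoint_notMem_interLocus hd he hf hg hfs hgs h hde k hP.1

end Counting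

end PlaneCurve

theorem mainTheorem3 (d e : ℕ) (hd : 1 ≤ d) (he : 1 ≤ e)
    (f g : MvPolynomial (Fin 3) ℝ)
    (hf : f.IsHomogeneous d) (hg : g.IsHomogeneous e)
    (hfsymm : f.IsSymmetric) (hgsymm : g.IsSymmetric)
    (htrans : PlaneCurve.Transverse (PlaneCurve.complexify f) (PlaneCurve.complexify g)) :
    ((d * e ≡ 3 [MOD 6] ∨ d * e ≡ 5 [MOD 6]) →
      ∃ k : ℕ, (k : ℚ) < ((d * e : ℕ) : ℚ) / 6 ∧
        {P ∈ PlaneCurve.interLocus (PlaneCurve.complexify f) (PlaneCurve.complexify g) |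
          PlaneCurve.IsRealPoint P}.encard = ((3 + 6 * k : ℕ) : ℕ∞)) ∧
    ((d * e ≡ 0 [MOD 6] ∨ d * e ≡ 2 [MOD 6]) →
      ∃ k : ℕ, (k : ℚ) ≤ ((d * e : ℕ) : ℚ) / 6 ∧
        {P ∈ PlaneCurve.interLocus (PlaneCurve.complexify f) (PlaneCurve.complexify g) |
          PlaneCurve.IsRealPoint P}.encard = ((6 * k : ℕ) : ℕ∞)) := by
  have hF := hf.map Complex.ofRealHom
  have hG := hg.map Complex.ofRealHom
  have hFs := hfsymm.map Complex.ofRealHom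
  have hGs := hgsymm.map Complex.ofRealHom
  have hle := PlaneCurve.encard_realPoints_le hd he hF hG htrans
  constructor
  · intro hmod
    have hodd : Odd (d * e) := by
      rw [Nat.odd_iff]
      rcases hmod with h | h <;> unfold Nat.ModEq at h <;> omega
    obtain ⟨k, hk⟩ := PlaneCurve.exists_encard_realPoints_of_odd hd he hF hG hFs hGs htrans hodd
    refine ⟨k, ?_, hk⟩
    -- The three exceptional points make the bound on `k` strict: `3 + 6 * k ≤ d * e`.
    rw [hk, Nat.cast_le] at hle
    have : ((3 + 6 * k : ℕ) : ℚ) ≤ (d * e : ℕ) := Nat.cast_le.2 hle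
    push_cast at this ⊢
    linarith
  · intro hmod
    have heven : Even (d * e) := by
      rw [Nat.even_iff]
      rcases hmod with h | h <;> unfold Nat.ModEq at h <;> omega
    obtain ⟨k, hk⟩ := PlaneCurve.exists_encard_realPoints_of_even hd he hF hG hFs hGs htrans heven
    refine ⟨k, ?_, hk⟩
    rw [hk, Nat.cast_le] at hle
    have : ((6 * k : ℕ) : ℚ) ≤ (d * e : ℕ) := Nat.cast_le.2 hle
    push_cast at this ⊢
    linarith
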